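/- Let $q=2^r$ with $r\ge 1$, let $\mathcal X=\{0,1,\dots,q-1\}$, and let $W:\mathcal X\to\mathcal Y$ be a discrete memoryless channel with finite output alphabet, given by transition probabilities $W(y|x)$. With addition of inputs modulo $q$, define the channels $$W^-(y_1,y_2|u_1)=\sum_{u_2\in\mathcal X}\tfrac1q W(y_1|u_1+u_2)W(y_2|u_2),\qquad W^+(y_1,y_2,u_1|u_2)=\tfrac1q W(y_1|u_1+u_2)W(y_2|u_2)$$ (the kernel $H_2$), and recursively $W^{b_1\dots b_{n+1}}=(W^{b_1\dots b_n})^{b_{n+1}}$ for $b_j\in\{+,-\}$. Let $B_1,B_2,\dots$ be i.i.d. uniform $\{+,-\}$-valued random variables, realized as the coordinates on the space of infinite sign sequences with the product probability measure, and let $W_n=W^{B_1\dots B_n}$ be the random virtual channel at time $n$ (with $W_0=W$). For a channel $V$ with input alphabet $\mathcal X$, let $$I(V)=\sum_{x}\sum_{y}\tfrac1q V(y|x)\log_2\frac{V(y|x)}{\sum_{x'}\frac1q V(y|x')}$$ be its symmetric capacity. Identify $v\in\mathcal X$ with the bit vector $(v_1,\dots,v_r)$, $v_1$ being the most significant bit,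 put $\mathrm{wt}(v)=\max\{j: v_j\ne0\}$ (and $\mathrm{wt}(0)=0$), and for $i=1,\dots,r$ let $$Z_i(V)=\frac1{2^{i-1}}\sum_{v:\,\mathrm{wt}(v)=i}\ \frac1q\sum_{x\in\mathcal X}\sum_{y}\sqrt{V(y|x)V(y|x+v)} .$$ Write $I_n=I(W_n)$ and $Z_{i,n}=Z_i(W_n)$. (a) As $n\to\infty$, $I_n$ converges almost everywhere to an integrable random variable $I_\infty$ with $E(I_\infty)=I(W)$. (b) For every $i=1,\dots,r$, $Z_{i,n}$ converges almost everywhere to a random variable $Z_{i,\infty}$ with values in $\{0,1\}$. With probability one, the vector $(Z_{1,\infty},\dots,Z_{r,\infty})$ is one of the $r+1$ vectors $1^k0^{r-k}$, $k=0,1,\dots,r$; that is, its first $k$ entries are $1$ and the others are $0$. -/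

import Mathlib

open MeasureTheory ProbabilityTheory Filter Topology

namespace PolarQ

universe u

/-- The input alphabet `{0, …, q - 1}`, `q = 2 ^ r`, with addition modulo `q`. -/
abbrev Input (r : ℕ) : Type := ZMod (2 ^ r)

/-- A discrete memoryless channel with input alphabet `{0, …, 2 ^ r - 1}` and a finite output
alphabet: a stochastic matrix `W(y|x)`, written `W.prob x y`. -/
structure Channel (r : ℕ) : Type (u + 1) where
  Out : Type u
  [fintypeOut : Fintype Out]
  prob : Input r → Out → ℝ
  prob_nonneg : ∀ x y, 0 ≤ prob x y
  sum_prob : ∀ x, ∑ y, prob x y = 1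

attribute [instance] Channel.fintypeOut

namespace Channel

variable {r : ℕ}

/-- The combined channel
`W₂(y₁, y₂ | u₁, u₂) = W(y₁ | u₁ + u₂) W(y₂ | u₂)`, with addition modulo `2 ^ r`. -/
def comb (W : Channel.{u} r) (u₁ u₂ : Input r) (y₁ y₂ : W.Out) : ℝ :=
  W.prob (u₁ + u₂) y₁ * W.prob u₂ y₂

theorem comb_nonneg (W : Channel.{u} r) (u₁ u₂ : Input r) (y₁ y₂ : W.Out) :
    0 ≤ W.comb u₁ u₂ y₁ y₂ :=
  mul_nonneg (W.prob_nonneg _ _) (W.prob_nonneg _ _)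

theorem sum_comb (W : Channel.{u} r) (u₁ u₂ : Input r) :
    ∑ y₁, ∑ y₂, W.comb u₁ u₂ y₁ y₂ = 1 := by
  simp only [comb, ← Finset.mul_sum, W.sum_prob, mul_one]

theorem sum_inv_card (r : ℕ) : ∑ _u : Input r, (1 / 2 ^ r : ℝ) = 1 := by
  simp [ZMod.card]

/-- `W⁻(y₁, y₂ | u₁) = ∑_{u₂} (1 / q) W₂(y₁, y₂ | u₁, u₂)`. -/
noncomputable def minus (W : Channel.{u} r) : Channel.{u} r where
  Out := W.Out × W.Out
  prob u₁ y := ∑ u₂ : Input r, (1 / 2 ^ r : ℝ) * W.comb u₁ u₂ y.1 y.2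
  prob_nonneg _ _ := Finset.sum_nonneg fun _ _ =>
    mul_nonneg (by positivity) (W.comb_nonneg _ _ _ _)
  sum_prob u₁ := by
    rw [Finset.sum_comm]
    simp only [← Finset.mul_sum, Fintype.sum_prod_type, W.sum_comb, mul_one]
    exact sum_inv_card r

/-- `W⁺(y₁, y₂, u₁ | u₂) = (1 / q) W₂(y₁, y₂ | u₁, u₂)`. -/
noncomputable def plus (W : Channel.{u} r) : Channel.{u} r where
  Out := (W.Out × W.Out) × Input r
  prob u₂ y := (1 / 2 ^ r : ℝ) * W.comb y.2 u₂ y.1.1 y.1.2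
  prob_nonneg _ _ := mul_nonneg (by positivity) (W.comb_nonneg _ _ _ _)
  sum_prob u₂ := by
    rw [Fintype.sum_prod_type, Finset.sum_comm]
    simp only [← Finset.mul_sum, Fintype.sum_prod_type, W.sum_comb, mul_one]
    exact sum_inv_card r

/-- The symmetric capacity `I(W)`, in bits (with `0 log 0 = 0`). -/
noncomputable def symCapacity (W : Channel.{u} r) : ℝ :=
  ∑ x : Input r, ∑ y : W.Out, (1 / 2 ^ r : ℝ) * W.prob x y *
    Real.logb 2 (W.prob x y / ∑ x' : Input r, (1 / 2 ^ r : ℝ) * W.prob x' y)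

/-- The Bhattacharyya distance `Z(W_{x,x'}) = ∑_y √(W(y|x) W(y|x'))` between two input symbols. -/
noncomputable def bhatt (W : Channel.{u} r) (x x' : Input r) : ℝ :=
  ∑ y : W.Out, √(W.prob x y * W.prob x' y)

/-- `Z_v(W) = 2^{-r} ∑_x Z(W_{x,x+v})`. -/
noncomputable def bhattShift (W : Channel.{u} r) (v : Input r) : ℝ :=
  (1 / 2 ^ r : ℝ) * ∑ x : Input r, W.bhatt x (x + v)

end Channel

/-- The symbol `x ∈ {0, …, 2 ^ r - 1}` is identified with the bit vector `(x₁, …, x_r)` where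
`x₁` is the most significant and `x_r` the least significant bit; `bit x j` is `x_j`,
`1 ≤ j ≤ r`. -/
def bit {r : ℕ} (x : Input r) (j : ℕ) : Bool :=
  (ZMod.val x).testBit (r - j)

/-- The ordered weight `max {j : x_j ≠ 0}` of a symbol (and `0` for the zero symbol). -/
def orderedWeight {r : ℕ} (x : Input r) : ℕ :=
  ((Finset.Icc 1 r).filter fun j => bit x j = true).sup id

/-- The `i`-th average Bhattacharyya distance
`Z_i(W) = 2^{-(i-1)} ∑_{v : wt(v) = i} Z_v(W)`, for `1 ≤ i ≤ r`. -/
noncomputable def Channel.avgBhatt {r : ℕ} (W : Channel.{u} r) (i : ℕ) : ℝ :=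
  (1 / 2 ^ (i - 1) : ℝ) *
    ∑ v ∈ (Finset.univ : Finset (Input r)).filter (fun v => orderedWeight v = i), W.bhattShift v

/-- Semi-infinite sequences of signs; `true` stands for `+`, `false` for `-`, and the sign `B_{n+1}`
of `ω` is `ω n`. The σ-algebra is the product one, generated by the cylinder sets. -/
abbrev SignSeq : Type := ℕ → Bool

/-- The law of a fair sign. -/
noncomputable def fairSign : Measure Bool := (PMF.uniformOfFintype Bool).toMeasure

instance : IsProbabilityMeasure fairSign := by
  unfold fairSign
  infer_instance

/-- The probability measure on sign sequences for which the signs are i.i.d. and fair, that is,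
every cylinder set `S(b₁, …, b_n)` has measure `2 ^ (-n)`. -/
noncomputable def signMeasure : Measure SignSeq := Measure.infinitePi fun _ => fairSign

instance : IsProbabilityMeasure signMeasure := by
  unfold signMeasure
  infer_instance

/-- The random channel `W_n = W^{B₁ B₂ … B_n}`, where `W^{b₁ … b_{n+1}} = (W^{b₁ … b_n})^{b_{n+1}}`. -/
noncomputable def virtualChannel {r : ℕ} (W : Channel.{u} r) (ω : SignSeq) : ℕ → Channel.{u} r
  | 0 => W
  | n + 1 => if ω n then (virtualChannel W ω n).plus else (virtualChannel W ω n).minus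

end PolarQ

/-!
The capacities `I_n` form a bounded martingale, because `I(W⁻) + I(W⁺) = 2 I(W)` (the chain rule,
`symCapacity_minus_add_plus`). It converges almost surely and in mean, which is part (a); moreover
its increments, whose absolute value is the loss `I(W_n) - I(W_n⁻)`, tend to zero almost surely.
From here on a single path is considered.

The loss is the conditional mutual information `I(U₁; U₂ | Y₁, Y₂)`, a relative entropy, hence it
dominates a squared Hellinger distance (`hellinger_le`). If it is small, the posterior law of the
input given the output is nearly invariant under translation by any `v` that occurs with
non-negligible probability as the difference of two posterior samples. Quantitatively, with `Z_v`
the average Bhattacharyya distance between `x` and `x + v`,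
`Z_v² (1 - Z_v) ≤ 2 q log 2 · (I(W) - I(W⁻))` (`bhattShift_sq_mul_le`).
So along the path every `Z_v` eventually stays near `{0, 1}`.

The set of `v` with `Z_v` near `1` is a subgroup of `ℤ/2^r`, as `1 - Z_v` is half a squared `L²`
distance between `√P` and its translate by `v` (`one_sub_bhattShift_add_le`). This subgroup is
eventually constant, since no `Z_v` can jump between a neighbourhood of `0` and one of `1`:
`Z_v(W⁺) = Z_v(W)²` and `Z_v(W) ≤ Z_v(W⁻) ≤ ∑_d Z_d(W) Z_{v+d}(W)`, and in the last sum one of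
`d`, `v + d` lies outside the subgroup if `v` does. Therefore each `Z_v` converges to the indicator
of a subgroup (`exists_tendsto_bhattShift`). The subgroups of `ℤ/2^r` are the balls `{v | wt v ≤ k}`
(`exists_mem_iff_orderedWeight_le`), and averaging over `wt v = i` gives the vectors `1^k 0^{r-k}`.
-/

namespace PolarQ

universe u

/-! ### Entropy form of the capacity and its chain rule -/

namespace Channel

variable {r : ℕ}

/-- The joint law `P(x, y) = 2^{-r} W(y|x)` of a uniform input and the corresponding output. -/
noncomputable def joint (W : Channel.{u} r) (x : Input r) (y : W.Out) : ℝ :=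
  (1 / 2 ^ r : ℝ) * W.prob x y

/-- The law of the output when the input is uniform. -/
noncomputable def outLaw (W : Channel.{u} r) (y : W.Out) : ℝ := ∑ x, W.joint x y

/-- `∑ P(x, y) log P(x, y)`, the negative of the entropy (in nats) of the input-output pair. -/
noncomputable def jointNegEnt (W : Channel.{u} r) : ℝ :=
  ∑ x, ∑ y, W.joint x y * Real.log (W.joint x y)

/-- `∑ P(y) log P(y)`, the negative of the entropy (in nats) of the output. -/
noncomputable def outNegEnt (W : Channel.{u} r) : ℝ :=
  ∑ y, W.outLaw y * Real.log (W.outLaw y)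

section Laws

variable (W : Channel.{u} r)

theorem joint_nonneg (x : Input r) (y : W.Out) : 0 ≤ W.joint x y :=
  mul_nonneg (by positivity) (W.prob_nonneg _ _)

theorem outLaw_nonneg (y : W.Out) : 0 ≤ W.outLaw y :=
  Finset.sum_nonneg fun _ _ => W.joint_nonneg _ _

theorem joint_le_outLaw (x : Input r) (y : W.Out) : W.joint x y ≤ W.outLaw y :=
  Finset.single_le_sum (f := fun x => W.joint x y) (fun _ _ => W.joint_nonneg _ _)
    (Finset.mem_univ x)

theorem sum_joint : ∑ x, ∑ y, W.joint x y = 1 := by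
  simp only [joint, ← Finset.mul_sum, W.sum_prob, mul_one]
  exact sum_inv_card r

theorem sum_outLaw : ∑ y, W.outLaw y = 1 := by
  simp only [outLaw]
  rw [Finset.sum_comm, W.sum_joint]

theorem sum_joint_add_right (v : Input r) : ∑ x, ∑ y, W.joint (x + v) y = 1 := by
  exact (Equiv.sum_comp (Equiv.addRight v) fun x => ∑ y, W.joint x y).trans W.sum_joint

/-- The capacity as `log q + H(Y) - H(X, Y)`. -/
theorem symCapacity_mul_log_two :
    W.symCapacity * Real.log 2 = r * Real.log 2 + W.jointNegEnt - W.outNegEnt := by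
  have h2 : Real.log 2 ≠ 0 := (Real.log_pos one_lt_two).ne'
  have key : ∀ x y, (1 / 2 ^ r : ℝ) * W.prob x y *
      Real.logb 2 (W.prob x y / ∑ x' : Input r, (1 / 2 ^ r : ℝ) * W.prob x' y) * Real.log 2 =
      W.joint x y * (r * Real.log 2) + W.joint x y * Real.log (W.joint x y) -
        W.joint x y * Real.log (W.outLaw y) := by
    intro x y
    change W.joint x y * Real.logb 2 (W.prob x y / W.outLaw y) * _ = _
    rcases eq_or_ne (W.joint x y) 0 with h | h
    · simp [h]
    · have hp : W.prob x y ≠ 0 := fun h' => h (by simp [joint, h'])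
      have hm : W.outLaw y ≠ 0 :=
        (((W.joint_nonneg x y).lt_of_ne' h).trans_le (W.joint_le_outLaw x y)).ne'
      have hj : Real.log (W.joint x y) = Real.log (W.prob x y) - r * Real.log 2 := by
        rw [joint, Real.log_mul (by positivity) hp, one_div, Real.log_inv, Real.log_pow]
        ring
      rw [hj, Real.logb, Real.log_div hp hm]
      field_simp
      ring
  simp only [symCapacity, Finset.sum_mul, key, Finset.sum_add_distrib, Finset.sum_sub_distrib]
  rw [← jointNegEnt]
  congr 1
  · congr 1
    simp only [← Finset.sum_mul, W.sum_joint, one_mul]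
  · rw [Finset.sum_comm]
    simp only [← Finset.sum_mul, outNegEnt, outLaw]

theorem symCapacity_le : W.symCapacity ≤ r := by
  have h2 : 0 < Real.log 2 := Real.log_pos one_lt_two
  refine le_of_mul_le_mul_right ?_ h2
  rw [symCapacity_mul_log_two]
  suffices W.jointNegEnt ≤ W.outNegEnt by linarith
  rw [jointNegEnt, outNegEnt, Finset.sum_comm]
  refine Finset.sum_le_sum fun y _ => ?_
  conv_rhs => rw [outLaw, Finset.sum_mul]
  refine Finset.sum_le_sum fun x _ => ?_
  rcases (W.joint_nonneg x y).eq_or_lt with h | h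
  · simp [← h]
  · exact mul_le_mul_of_nonneg_left (Real.log_le_log h (W.joint_le_outLaw x y)) h.le

end Laws

/-- The lower bound for a relative entropy by the squared Hellinger distance, before summation. -/
theorem sq_sqrt_sub_sqrt_le {p q : ℝ} (hp : 0 ≤ p) (hq : 0 ≤ q) (h : q = 0 → p = 0) :
    (√p - √q) ^ 2 + p - q ≤ p * (Real.log p - Real.log q) := by
  rcases hp.eq_or_lt with rfl | hp
  · simp [Real.sq_sqrt hq]
  have hq : 0 < q := hq.lt_of_ne' fun h' => hp.ne' (h h')
  have hsp := Real.sqrt_pos.2 hp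
  have hsq := Real.sqrt_pos.2 hq
  have h1 := Real.log_le_sub_one_of_pos (div_pos hsq hsp)
  rw [Real.log_div hsq.ne' hsp.ne', Real.log_sqrt hq.le, Real.log_sqrt hp.le] at h1
  have h2 : p * (√q / √p) = √p * √q := by
    field_simp
    rw [Real.sq_sqrt hp.le]
  have h3 := mul_le_mul_of_nonneg_left h1 hp.le
  rw [mul_sub p (√q / √p), h2] at h3
  nlinarith [Real.sq_sqrt hp.le, Real.sq_sqrt hq.le]

theorem symCapacity_nonneg (W : Channel.{u} r) : 0 ≤ W.symCapacity := by
  have h2 : 0 < Real.log 2 := Real.log_pos one_lt_two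
  refine nonneg_of_mul_nonneg_left ?_ h2
  rw [symCapacity_mul_log_two]
  have key : ∀ x y, W.joint x y - 1 / 2 ^ r * W.outLaw y ≤
      W.joint x y * (r * Real.log 2) + W.joint x y * Real.log (W.joint x y) -
        W.joint x y * Real.log (W.outLaw y) := by
    intro x y
    rcases (W.outLaw_nonneg y).eq_or_lt with hm | hm
    · have : W.joint x y = 0 :=
        le_antisymm (hm ▸ W.joint_le_outLaw x y) (W.joint_nonneg x y)
      simp [this, ← hm]
    · have := sq_sqrt_sub_sqrt_le (W.joint_nonneg x y)
        (q := 1 / 2 ^ r * W.outLaw y) (by positivity) (fun h => absurd h (by positivity))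
      rw [Real.log_mul (by positivity) hm.ne', one_div, Real.log_inv, Real.log_pow] at this
      rw [one_div]
      nlinarith [sq_nonneg (√(W.joint x y) - √((2 ^ r)⁻¹ * W.outLaw y))]
  have := Finset.sum_le_sum fun x (_ : x ∈ Finset.univ) =>
    Finset.sum_le_sum fun y (_ : y ∈ Finset.univ) => key x y
  simp only [Finset.sum_add_distrib, Finset.sum_sub_distrib, ← Finset.sum_mul, ← Finset.mul_sum,
    W.sum_joint, W.sum_outLaw] at this
  have h3 : ∑ x, ∑ y, W.joint x y * Real.log (W.outLaw y) = W.outNegEnt := by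
    rw [Finset.sum_comm]
    simp only [← Finset.sum_mul, outNegEnt, outLaw]
  rw [h3, ← jointNegEnt] at this
  have h4 := sum_inv_card r
  simp only [mul_one, h4] at this
  linarith

section Transforms

variable (W : Channel.{u} r)

theorem joint_minus (u₁ : Input r) (y : W.Out × W.Out) :
    W.minus.joint u₁ y = ∑ u₂, W.joint (u₁ + u₂) y.1 * W.joint u₂ y.2 := by
  simp only [joint, minus, comb, Finset.mul_sum]
  exact Finset.sum_congr rfl fun _ _ => by ring

theorem joint_plus (u₂ : Input r) (y : (W.Out × W.Out) × Input r) :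
    W.plus.joint u₂ y = W.joint (y.2 + u₂) y.1.1 * W.joint u₂ y.1.2 := by
  simp only [joint, plus, comb]
  ring

theorem sum_joint_add_left (u : Input r) (y : W.Out) :
    ∑ x, W.joint (x + u) y = W.outLaw y := by
  rw [outLaw]
  exact Equiv.sum_comp (Equiv.addRight u) fun x => W.joint x y

theorem outLaw_minus (y : W.Out × W.Out) :
    W.minus.outLaw y = W.outLaw y.1 * W.outLaw y.2 := by
  simp only [outLaw, joint_minus]
  rw [Finset.sum_comm]
  simp only [← Finset.sum_mul, sum_joint_add_left, ← Finset.mul_sum]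
  rfl

theorem outLaw_plus (y : (W.Out × W.Out) × Input r) :
    W.plus.outLaw y = W.minus.joint y.2 y.1 := by
  simp only [outLaw, joint_plus, joint_minus]

theorem outNegEnt_plus : W.plus.outNegEnt = W.minus.jointNegEnt := by
  have : W.plus.outNegEnt = ∑ y : (W.Out × W.Out) × Input r,
      W.minus.joint y.2 y.1 * Real.log (W.minus.joint y.2 y.1) :=
    Finset.sum_congr rfl fun y _ => congrArg (fun t => t * Real.log t) (W.outLaw_plus y)
  rw [this, Fintype.sum_prod_type_right]
  rfl

theorem mul_mul_log_mul (a b : ℝ) :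
    a * b * Real.log (a * b) = b * (a * Real.log a) + a * (b * Real.log b) := by
  have := Real.negMulLog_mul a b
  simp only [Real.negMulLog] at this
  linarith

theorem outNegEnt_minus : W.minus.outNegEnt = 2 * W.outNegEnt := by
  have : W.minus.outNegEnt = ∑ y : W.Out × W.Out, W.outLaw y.1 * W.outLaw y.2 *
      Real.log (W.outLaw y.1 * W.outLaw y.2) :=
    Finset.sum_congr rfl fun y _ => congrArg (fun t => t * Real.log t) (W.outLaw_minus y)
  rw [this, Fintype.sum_prod_type]
  simp only [mul_mul_log_mul, Finset.sum_add_distrib, ← Finset.sum_mul, ← Finset.mul_sum,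
    W.sum_outLaw, one_mul]
  rw [← outNegEnt, two_mul]

theorem jointNegEnt_plus : W.plus.jointNegEnt = 2 * W.jointNegEnt := by
  have : W.plus.jointNegEnt = ∑ u₂, ∑ y : (W.Out × W.Out) × Input r,
      W.joint (y.2 + u₂) y.1.1 * W.joint u₂ y.1.2 *
        Real.log (W.joint (y.2 + u₂) y.1.1 * W.joint u₂ y.1.2) :=
    Finset.sum_congr rfl fun u₂ _ => Finset.sum_congr rfl fun y _ =>
      congrArg (fun t => t * Real.log t) (W.joint_plus u₂ y)
  rw [this]
  simp only [mul_mul_log_mul]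
  have hshift : ∀ u₂, ∑ u₁, ∑ y, W.joint (u₁ + u₂) y * Real.log (W.joint (u₁ + u₂) y) =
      W.jointNegEnt := fun u₂ =>
    Equiv.sum_comp (Equiv.addRight u₂) fun x => ∑ y, W.joint x y * Real.log (W.joint x y)
  have h : ∀ u₂, ∑ y : (W.Out × W.Out) × Input r,
      (W.joint u₂ y.1.2 * (W.joint (y.2 + u₂) y.1.1 * Real.log (W.joint (y.2 + u₂) y.1.1)) +
        W.joint (y.2 + u₂) y.1.1 * (W.joint u₂ y.1.2 * Real.log (W.joint u₂ y.1.2))) =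
      (∑ y, W.joint u₂ y) * W.jointNegEnt + ∑ y, W.joint u₂ y * Real.log (W.joint u₂ y) := by
    intro u₂
    rw [Fintype.sum_prod_type_right]
    simp only [Fintype.sum_prod_type, Finset.sum_add_distrib, ← Finset.mul_sum, ← Finset.sum_mul]
    rw [hshift, sum_joint_add_right, one_mul]
  simp only [h, Finset.sum_add_distrib, ← Finset.sum_mul, W.sum_joint]
  rw [← jointNegEnt]
  ring

/-- The chain rule `I(U₁; Y₁Y₂) + I(U₂; Y₁Y₂U₁) = 2 I(X; Y)`. -/
theorem symCapacity_minus_add_plus :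
    W.minus.symCapacity + W.plus.symCapacity = 2 * W.symCapacity := by
  have h2 : Real.log 2 ≠ 0 := (Real.log_pos one_lt_two).ne'
  refine mul_right_cancel₀ h2 ?_
  rw [add_mul, mul_assoc, symCapacity_mul_log_two, symCapacity_mul_log_two,
    symCapacity_mul_log_two, outNegEnt_plus, outNegEnt_minus, jointNegEnt_plus]
  ring

theorem symCapacity_sub_minus_mul_log_two :
    (W.symCapacity - W.minus.symCapacity) * Real.log 2 =
      W.jointNegEnt + W.outNegEnt - W.minus.jointNegEnt := by
  rw [sub_mul, symCapacity_mul_log_two, symCapacity_mul_log_two, outNegEnt_minus]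
  ring

end Transforms

/-! ### Bhattacharyya parameters under the two transforms -/

section Bhattacharyya

variable (W : Channel.{u} r)

theorem bhattShift_eq_sum (v : Input r) :
    W.bhattShift v = ∑ x, ∑ y, √(W.joint x y * W.joint (x + v) y) := by
  simp only [bhattShift, bhatt, Finset.mul_sum]
  refine Finset.sum_congr rfl fun x _ => Finset.sum_congr rfl fun y _ => ?_
  have h : W.joint x y * W.joint (x + v) y =
      (1 / 2 ^ r) ^ 2 * (W.prob x y * W.prob (x + v) y) := by
    simp only [joint]
    ring
  rw [h, Real.sqrt_mul (sq_nonneg _), Real.sqrt_sq (by positivity)]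

theorem bhattShift_nonneg (v : Input r) : 0 ≤ W.bhattShift v := by
  rw [bhattShift_eq_sum]
  positivity

theorem bhattShift_zero : W.bhattShift 0 = 1 := by
  simp only [bhattShift_eq_sum, add_zero, Real.sqrt_mul_self (W.joint_nonneg _ _), W.sum_joint]

/-- `1 - Z_v(W)` is half the squared `L²` distance between the amplitude `√P(x, y)` and its
translate by `v`. -/
theorem sum_sq_sqrt_joint_sub (v : Input r) :
    ∑ x, ∑ y, (√(W.joint x y) - √(W.joint (x + v) y)) ^ 2 = 2 * (1 - W.bhattShift v) := by
  have h : ∀ x y, (√(W.joint x y) - √(W.joint (x + v) y)) ^ 2 =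
      W.joint x y + W.joint (x + v) y - 2 * √(W.joint x y * W.joint (x + v) y) := by
    intro x y
    rw [sub_sq, Real.sq_sqrt (W.joint_nonneg _ _), Real.sq_sqrt (W.joint_nonneg _ _),
      Real.sqrt_mul (W.joint_nonneg _ _)]
    ring
  simp only [h, Finset.sum_sub_distrib, Finset.sum_add_distrib, ← Finset.mul_sum, W.sum_joint,
    sum_joint_add_right, ← bhattShift_eq_sum]
  ring

theorem bhattShift_le_one (v : Input r) : W.bhattShift v ≤ 1 := by
  have h : 0 ≤ ∑ x, ∑ y, (√(W.joint x y) - √(W.joint (x + v) y)) ^ 2 := by positivity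
  rw [sum_sq_sqrt_joint_sub] at h
  linarith

theorem one_sub_bhattShift_add_le (v w : Input r) :
    1 - W.bhattShift (v + w) ≤ 2 * (1 - W.bhattShift v) + 2 * (1 - W.bhattShift w) := by
  have hw : ∑ x, ∑ y, (√(W.joint (x + v) y) - √(W.joint (x + (v + w)) y)) ^ 2 =
      2 * (1 - W.bhattShift w) := by
    rw [← sum_sq_sqrt_joint_sub]
    simp only [← add_assoc]
    exact Equiv.sum_comp (Equiv.addRight v)
      fun x => ∑ y, (√(W.joint x y) - √(W.joint (x + w) y)) ^ 2
  have h : ∑ x, ∑ y, (√(W.joint x y) - √(W.joint (x + (v + w)) y)) ^ 2 ≤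
      ∑ x, ∑ y, (2 * (√(W.joint x y) - √(W.joint (x + v) y)) ^ 2 +
        2 * (√(W.joint (x + v) y) - √(W.joint (x + (v + w)) y)) ^ 2) := by
    refine Finset.sum_le_sum fun x _ => Finset.sum_le_sum fun y _ => ?_
    nlinarith [sq_nonneg (√(W.joint x y) - 2 * √(W.joint (x + v) y) +
      √(W.joint (x + (v + w)) y))]
  simp only [Finset.sum_add_distrib, ← Finset.mul_sum, hw, sum_sq_sqrt_joint_sub] at h
  linarith

theorem sum_sqrt_joint_shift (u v : Input r) :
    ∑ x, ∑ y, √(W.joint (x + u) y * W.joint (x + v) y) = W.bhattShift (v - u) := by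
  rw [bhattShift_eq_sum]
  refine Eq.trans (Finset.sum_congr rfl fun x _ => ?_) (Equiv.sum_comp (Equiv.addRight u)
    fun x => ∑ y, √(W.joint x y * W.joint (x + (v - u)) y))
  simp [add_assoc]

theorem bhattShift_neg (v : Input r) : W.bhattShift (-v) = W.bhattShift v := by
  rw [← zero_sub, ← sum_sqrt_joint_shift, bhattShift_eq_sum]
  simp only [add_zero, mul_comm]

theorem bhattShift_plus (v : Input r) : W.plus.bhattShift v = W.bhattShift v ^ 2 := by
  have h : W.plus.bhattShift v = ∑ u₂, ∑ y : (W.Out × W.Out) × Input r,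
      √(W.joint (y.2 + u₂) y.1.1 * W.joint (y.2 + (u₂ + v)) y.1.1) *
        √(W.joint u₂ y.1.2 * W.joint (u₂ + v) y.1.2) := by
    rw [bhattShift_eq_sum]
    refine Finset.sum_congr rfl fun u₂ _ => Finset.sum_congr rfl fun y _ => ?_
    refine (congrArg₂ (fun s t => √(s * t)) (W.joint_plus u₂ y) (W.joint_plus (u₂ + v) y)).trans ?_
    rw [mul_mul_mul_comm, Real.sqrt_mul (mul_nonneg (W.joint_nonneg _ _) (W.joint_nonneg _ _))]
  rw [h, sq]
  conv_rhs => enter [1]; rw [bhattShift_eq_sum]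
  rw [Finset.sum_mul]
  refine Finset.sum_congr rfl fun u₂ _ => ?_
  rw [Fintype.sum_prod_type_right]
  simp only [Fintype.sum_prod_type, ← Finset.mul_sum, ← Finset.sum_mul, sum_sqrt_joint_shift,
    add_sub_cancel_left]
  exact mul_comm _ _

theorem bhattShift_minus (v : Input r) :
    W.minus.bhattShift v = ∑ u₁, ∑ y₁, ∑ y₂, √((∑ a, W.joint (u₁ + a) y₁ * W.joint a y₂) *
      ∑ a, W.joint (u₁ + v + a) y₁ * W.joint a y₂) := by
  rw [bhattShift_eq_sum]
  refine Finset.sum_congr rfl fun u₁ _ => ?_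
  rw [← Fintype.sum_prod_type' (f := fun y₁ y₂ => √((∑ a, W.joint (u₁ + a) y₁ * W.joint a y₂) *
      ∑ a, W.joint (u₁ + v + a) y₁ * W.joint a y₂))]
  exact Finset.sum_congr rfl fun y _ => congrArg₂ (fun s t => √(s * t))
    (W.joint_minus u₁ y) (W.joint_minus (u₁ + v) y)

theorem sum_comm_four {α β γ δ : Type*} [Fintype α] [Fintype β] [Fintype γ] [Fintype δ]
    (f : α → β → γ → δ → ℝ) :
    ∑ a, ∑ b, ∑ c, ∑ d, f a b c d = ∑ c, ∑ d, ∑ a, ∑ b, f a b c d := by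
  have := Finset.sum_comm (s := (Finset.univ : Finset (α × β)))
    (t := (Finset.univ : Finset (γ × δ))) (f := fun p q => f p.1 p.2 q.1 q.2)
  simpa only [Fintype.sum_prod_type] using this

theorem sqrt_sum_le_sum_sqrt {ι : Type*} (s : Finset ι) (f : ι → ℝ) (hf : ∀ i, 0 ≤ f i) :
    √(∑ i ∈ s, f i) ≤ ∑ i ∈ s, √(f i) := by
  rw [Real.sqrt_le_left (Finset.sum_nonneg fun _ _ => Real.sqrt_nonneg _)]
  calc ∑ i ∈ s, f i = ∑ i ∈ s, √(f i) ^ 2 :=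
        Finset.sum_congr rfl fun i _ => (Real.sq_sqrt (hf i)).symm
    _ ≤ _ := Finset.sum_sq_le_sq_sum_of_nonneg fun _ _ => Real.sqrt_nonneg _

theorem bhattShift_le_minus (v : Input r) : W.bhattShift v ≤ W.minus.bhattShift v := by
  have hconc : ∀ u₁ y₁ y₂,
      ∑ a, √(W.joint (u₁ + a) y₁ * W.joint (u₁ + v + a) y₁) * W.joint a y₂ ≤
        √((∑ a, W.joint (u₁ + a) y₁ * W.joint a y₂) *
          ∑ a, W.joint (u₁ + v + a) y₁ * W.joint a y₂) := by
    intro u₁ y₁ y₂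
    have hn : ∀ a b, 0 ≤ W.joint a y₁ * W.joint b y₂ :=
      fun a b => mul_nonneg (W.joint_nonneg _ _) (W.joint_nonneg _ _)
    rw [Real.sqrt_mul (Finset.sum_nonneg fun _ _ => hn _ _)]
    refine le_trans (le_of_eq ?_) (Real.sum_sqrt_mul_sqrt_le _ (fun a => hn (u₁ + a) a)
      fun a => hn (u₁ + v + a) a)
    refine Finset.sum_congr rfl fun a _ => ?_
    rw [← Real.sqrt_mul (hn _ _), mul_mul_mul_comm,
      Real.sqrt_mul (mul_nonneg (W.joint_nonneg _ _) (W.joint_nonneg _ _)),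
      Real.sqrt_mul_self (W.joint_nonneg _ _)]
  rw [bhattShift_minus]
  refine le_trans (le_of_eq ?_) (Finset.sum_le_sum fun u₁ _ => Finset.sum_le_sum fun y₁ _ =>
    Finset.sum_le_sum fun y₂ _ => hconc u₁ y₁ y₂)
  calc W.bhattShift v = ∑ a, ∑ y₂, W.bhattShift v * W.joint a y₂ := by
        simp only [← Finset.mul_sum, W.sum_joint, mul_one]
    _ = ∑ a, ∑ y₂, (∑ u₁, ∑ y₁, √(W.joint (u₁ + a) y₁ * W.joint (u₁ + v + a) y₁)) *
          W.joint a y₂ := by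
        simp only [add_assoc, sum_sqrt_joint_shift, add_sub_cancel_right]
    _ = _ := by
        simp only [Finset.sum_mul]
        rw [Finset.sum_congr rfl fun a _ => Finset.sum_comm, Finset.sum_comm]
        refine Finset.sum_congr rfl fun u₁ _ => ?_
        rw [Finset.sum_congr rfl fun a _ => Finset.sum_comm, Finset.sum_comm]
        exact Finset.sum_congr rfl fun y₁ _ => Finset.sum_comm

theorem bhattShift_minus_le (v : Input r) :
    W.minus.bhattShift v ≤ ∑ d, W.bhattShift d * W.bhattShift (v + d) := by
  have hn : ∀ a b y₁ y₂, 0 ≤ W.joint a y₁ * W.joint b y₂ :=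
    fun a b _ _ => mul_nonneg (W.joint_nonneg _ _) (W.joint_nonneg _ _)
  have hsub : ∀ u₁ y₁ y₂, √((∑ a, W.joint (u₁ + a) y₁ * W.joint a y₂) *
      ∑ a, W.joint (u₁ + v + a) y₁ * W.joint a y₂) ≤
      ∑ a, ∑ d, √(W.joint a y₂ * W.joint (a + d) y₂) *
        √(W.joint (u₁ + a) y₁ * W.joint (u₁ + (v + a + d)) y₁) := by
    intro u₁ y₁ y₂
    rw [Finset.sum_mul_sum]
    refine (sqrt_sum_le_sum_sqrt _ _ fun a => Finset.sum_nonneg fun b _ =>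
      mul_nonneg (hn _ _ _ _) (hn _ _ _ _)).trans (Finset.sum_le_sum fun a _ => ?_)
    refine (sqrt_sum_le_sum_sqrt _ _ fun b => mul_nonneg (hn _ _ _ _) (hn _ _ _ _)).trans_eq ?_
    rw [← Equiv.sum_comp (Equiv.addLeft a)]
    refine Finset.sum_congr rfl fun d _ => ?_
    rw [Equiv.coe_addLeft, mul_mul_mul_comm,
      Real.sqrt_mul (mul_nonneg (W.joint_nonneg _ _) (W.joint_nonneg _ _)), mul_comm]
    simp only [add_assoc]
  rw [bhattShift_minus]
  refine (Finset.sum_le_sum fun u₁ _ => Finset.sum_le_sum fun y₁ _ =>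
    Finset.sum_le_sum fun y₂ _ => hsub u₁ y₁ y₂).trans (le_of_eq ?_)
  have hinner : ∀ f : W.Out → Input r → Input r → ℝ,
      ∑ y, ∑ a, ∑ d, f y a d = ∑ a, ∑ d, ∑ y, f y a d := fun f => by
    rw [Finset.sum_comm]
    exact Finset.sum_congr rfl fun a _ => Finset.sum_comm
  have hshift : ∀ a d, v + a + d - a = v + d := fun a d => by ring
  rw [Finset.sum_congr rfl fun u₁ _ => Finset.sum_congr rfl fun y₁ _ => hinner _]
  simp only [← Finset.sum_mul]
  rw [sum_comm_four, Finset.sum_comm]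
  simp only [← Finset.mul_sum, sum_sqrt_joint_shift, hshift]
  simp only [← Finset.sum_mul, ← bhattShift_eq_sum]

end Bhattacharyya

/-! ### Loss of capacity and Bhattacharyya parameters -/

section Capacity

variable (W : Channel.{u} r)

/-- The joint law of the input `U₁` of `W⁻` and its output `(Y₁, Y₂)`. -/
noncomputable def minusJoint (u₁ : Input r) (y₁ y₂ : W.Out) : ℝ :=
  ∑ u₂, W.joint (u₁ + u₂) y₁ * W.joint u₂ y₂

theorem minusJoint_nonneg (u₁ : Input r) (y₁ y₂ : W.Out) : 0 ≤ W.minusJoint u₁ y₁ y₂ :=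
  Finset.sum_nonneg fun _ _ => mul_nonneg (W.joint_nonneg _ _) (W.joint_nonneg _ _)

theorem sum_minusJoint (f : ℝ → ℝ) :
    ∑ u₁, ∑ y₁, ∑ y₂, f (W.minusJoint u₁ y₁ y₂) = ∑ u₁, ∑ y, f (W.minus.joint u₁ y) := by
  refine Finset.sum_congr rfl fun u₁ _ => ?_
  rw [← Fintype.sum_prod_type' (f := fun y₁ y₂ => f (W.minusJoint u₁ y₁ y₂))]
  exact Finset.sum_congr rfl fun y _ => congrArg f (W.joint_minus u₁ y).symm

theorem minusJoint_le (u₁ : Input r) (y₁ y₂ : W.Out) :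
    W.minusJoint u₁ y₁ y₂ ≤ W.outLaw y₁ * W.outLaw y₂ := by
  rw [minusJoint, outLaw.eq_1 W y₂, Finset.mul_sum]
  exact Finset.sum_le_sum fun u₂ _ =>
    mul_le_mul_of_nonneg_right (W.joint_le_outLaw _ _) (W.joint_nonneg _ _)

/-- The law of `(U₁, U₂, Y₁, Y₂)` if `U₁` and `U₂` were conditionally independent
given `(Y₁, Y₂)`. -/
noncomputable def condIndepLaw (u₁ u₂ : Input r) (y₁ y₂ : W.Out) : ℝ :=
  W.minusJoint u₁ y₁ y₂ / W.outLaw y₂ * W.joint u₂ y₂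

theorem condIndepLaw_nonneg (u₁ u₂ : Input r) (y₁ y₂ : W.Out) :
    0 ≤ W.condIndepLaw u₁ u₂ y₁ y₂ :=
  mul_nonneg (div_nonneg (W.minusJoint_nonneg _ _ _) (W.outLaw_nonneg _)) (W.joint_nonneg _ _)

theorem joint_mul_joint_le_minus (u₁ u₂ : Input r) (y₁ y₂ : W.Out) :
    W.joint (u₁ + u₂) y₁ * W.joint u₂ y₂ ≤ W.minusJoint u₁ y₁ y₂ := by
  exact Finset.single_le_sum (f := fun u₂ => W.joint (u₁ + u₂) y₁ * W.joint u₂ y₂)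
    (fun _ _ => mul_nonneg (W.joint_nonneg _ _) (W.joint_nonneg _ _)) (Finset.mem_univ u₂)

theorem sum_joint_mul_joint :
    ∑ u₁, ∑ u₂, ∑ y₁, ∑ y₂, W.joint (u₁ + u₂) y₁ * W.joint u₂ y₂ = 1 := by
  rw [Finset.sum_comm]
  simp only [← Finset.mul_sum, ← Finset.sum_mul, sum_joint_add_right, one_mul, W.sum_joint]

theorem sum_condIndepLaw :
    ∑ u₁, ∑ u₂, ∑ y₁, ∑ y₂, W.condIndepLaw u₁ u₂ y₁ y₂ = 1 := by
  have hm : ∀ u₁ y₁ y₂, W.minusJoint u₁ y₁ y₂ / W.outLaw y₂ * W.outLaw y₂ =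
      W.minusJoint u₁ y₁ y₂ := by
    intro u₁ y₁ y₂
    rcases eq_or_ne (W.outLaw y₂) 0 with h | h
    · have h' := W.minusJoint_le u₁ y₁ y₂
      rw [h, mul_zero] at h'
      rw [h, mul_zero, le_antisymm h' (W.minusJoint_nonneg _ _ _)]
    · rw [div_mul_cancel₀ _ h]
  have h : ∀ u₁, ∑ u₂, ∑ y₁, ∑ y₂, W.condIndepLaw u₁ u₂ y₁ y₂ =
      ∑ y₁, ∑ y₂, W.minusJoint u₁ y₁ y₂ := by
    intro u₁
    rw [Finset.sum_comm]
    refine Finset.sum_congr rfl fun y₁ _ => ?_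
    rw [Finset.sum_comm]
    refine Finset.sum_congr rfl fun y₂ _ => ?_
    rw [← hm, outLaw, Finset.mul_sum]
    rfl
  rw [Finset.sum_congr rfl fun u₁ _ => h u₁, W.sum_minusJoint fun t => t]
  exact W.minus.sum_joint

/-- The information lost by the `-` transform is the relative entropy
`I(U₁; U₂ | Y₁, Y₂)` of the law of `(U₁, U₂, Y₁, Y₂)` with respect to `condIndepLaw`. -/
theorem symCapacity_sub_minus_eq_relEnt :
    (W.symCapacity - W.minus.symCapacity) * Real.log 2 =
      ∑ u₁, ∑ u₂, ∑ y₁, ∑ y₂, W.joint (u₁ + u₂) y₁ * W.joint u₂ y₂ *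
        (Real.log (W.joint (u₁ + u₂) y₁ * W.joint u₂ y₂) -
          Real.log (W.condIndepLaw u₁ u₂ y₁ y₂)) := by
  have key : ∀ u₁ u₂ y₁ y₂, W.joint (u₁ + u₂) y₁ * W.joint u₂ y₂ *
        (Real.log (W.joint (u₁ + u₂) y₁ * W.joint u₂ y₂) -
          Real.log (W.condIndepLaw u₁ u₂ y₁ y₂)) =
      W.joint (u₁ + u₂) y₁ * Real.log (W.joint (u₁ + u₂) y₁) * W.joint u₂ y₂ +
        W.joint (u₁ + u₂) y₁ * (W.joint u₂ y₂ * Real.log (W.outLaw y₂)) -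
        W.joint (u₁ + u₂) y₁ * W.joint u₂ y₂ * Real.log (W.minusJoint u₁ y₁ y₂) := by
    intro u₁ u₂ y₁ y₂
    rcases eq_or_ne (W.joint (u₁ + u₂) y₁) 0 with h1 | h1
    · simp [h1]
    rcases eq_or_ne (W.joint u₂ y₂) 0 with h2 | h2
    · simp [h2]
    have p1 := (W.joint_nonneg (u₁ + u₂) y₁).lt_of_ne' h1
    have p2 := (W.joint_nonneg u₂ y₂).lt_of_ne' h2
    have pm := p2.trans_le (W.joint_le_outLaw u₂ y₂)
    have pJ := (mul_pos p1 p2).trans_le (W.joint_mul_joint_le_minus u₁ u₂ y₁ y₂)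
    rw [condIndepLaw, Real.log_mul h1 h2, Real.log_mul (div_pos pJ pm).ne' h2,
      Real.log_div pJ.ne' pm.ne']
    ring
  have hS : ∑ u₁, ∑ u₂, ∑ y₁, ∑ y₂,
      W.joint (u₁ + u₂) y₁ * Real.log (W.joint (u₁ + u₂) y₁) * W.joint u₂ y₂ =
      W.jointNegEnt := by
    have hshift : ∀ u₂, ∑ u₁, ∑ y, W.joint (u₁ + u₂) y * Real.log (W.joint (u₁ + u₂) y) =
        W.jointNegEnt := fun u₂ =>
      Equiv.sum_comp (Equiv.addRight u₂) fun x => ∑ y, W.joint x y * Real.log (W.joint x y)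
    rw [Finset.sum_comm]
    simp only [← Finset.mul_sum, ← Finset.sum_mul, hshift]
    simp only [Finset.mul_sum]
    simp only [← Finset.mul_sum, W.sum_joint, mul_one]
  have hM : ∑ u₁, ∑ u₂, ∑ y₁, ∑ y₂,
      W.joint (u₁ + u₂) y₁ * (W.joint u₂ y₂ * Real.log (W.outLaw y₂)) = W.outNegEnt := by
    rw [Finset.sum_comm]
    simp only [← Finset.mul_sum, ← Finset.sum_mul, sum_joint_add_right, one_mul]
    rw [Finset.sum_comm]
    simp only [← Finset.sum_mul, outNegEnt, outLaw]
  have hJ : ∑ u₁, ∑ u₂, ∑ y₁, ∑ y₂, W.joint (u₁ + u₂) y₁ * W.joint u₂ y₂ *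
      Real.log (W.minusJoint u₁ y₁ y₂) = W.minus.jointNegEnt := by
    refine Eq.trans (Finset.sum_congr rfl fun u₁ _ => ?_)
      (W.sum_minusJoint fun t => t * Real.log t)
    rw [Finset.sum_comm]
    refine Finset.sum_congr rfl fun y₁ _ => ?_
    rw [Finset.sum_comm]
    refine Finset.sum_congr rfl fun y₂ _ => ?_
    rw [← Finset.sum_mul, minusJoint]
  simp only [key, Finset.sum_sub_distrib, Finset.sum_add_distrib, hS, hM, hJ]
  exact W.symCapacity_sub_minus_mul_log_two

theorem hellinger_le :
    ∑ u₁, ∑ u₂, ∑ y₁, ∑ y₂, (√(W.joint (u₁ + u₂) y₁ * W.joint u₂ y₂) -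
      √(W.condIndepLaw u₁ u₂ y₁ y₂)) ^ 2 ≤
      (W.symCapacity - W.minus.symCapacity) * Real.log 2 := by
  have h : ∀ u₁ u₂ y₁ y₂, (√(W.joint (u₁ + u₂) y₁ * W.joint u₂ y₂) -
      √(W.condIndepLaw u₁ u₂ y₁ y₂)) ^ 2 + W.joint (u₁ + u₂) y₁ * W.joint u₂ y₂ -
        W.condIndepLaw u₁ u₂ y₁ y₂ ≤ W.joint (u₁ + u₂) y₁ * W.joint u₂ y₂ *
        (Real.log (W.joint (u₁ + u₂) y₁ * W.joint u₂ y₂) -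
          Real.log (W.condIndepLaw u₁ u₂ y₁ y₂)) := by
    intro u₁ u₂ y₁ y₂
    refine sq_sqrt_sub_sqrt_le (mul_nonneg (W.joint_nonneg _ _) (W.joint_nonneg _ _))
      (W.condIndepLaw_nonneg _ _ _ _) fun h => ?_
    have hle := W.joint_mul_joint_le_minus u₁ u₂ y₁ y₂
    have hm := W.joint_le_outLaw u₂ y₂
    have h0 := W.joint_nonneg (u₁ + u₂) y₁
    have h1 := W.joint_nonneg u₂ y₂
    rcases mul_eq_zero.1 h with h | h
    · rcases div_eq_zero_iff.1 h with h | h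
      · exact le_antisymm (h ▸ hle) (mul_nonneg h0 h1)
      · rw [le_antisymm (h ▸ hm) h1, mul_zero]
    · rw [h, mul_zero]
  have := Finset.sum_le_sum fun u₁ (_ : u₁ ∈ Finset.univ) => Finset.sum_le_sum
    fun u₂ (_ : u₂ ∈ Finset.univ) => Finset.sum_le_sum fun y₁ (_ : y₁ ∈ Finset.univ) =>
      Finset.sum_le_sum fun y₂ (_ : y₂ ∈ Finset.univ) => h u₁ u₂ y₁ y₂
  simp only [Finset.sum_add_distrib, Finset.sum_sub_distrib, sum_joint_mul_joint,
    sum_condIndepLaw] at this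
  rw [symCapacity_sub_minus_eq_relEnt]
  simp only [mul_sub, Finset.sum_sub_distrib] at this ⊢
  linarith

/-- The probability that two inputs drawn independently from the posterior law given the output
differ by `v`. Outputs of probability zero contribute `0 / 0 = 0`. -/
noncomputable def collision (v : Input r) : ℝ :=
  ∑ x, ∑ y, W.joint x y * W.joint (x + v) y / W.outLaw y

theorem bhattShift_sq_le (v : Input r) : W.bhattShift v ^ 2 ≤ 2 ^ r * W.collision v := by
  have hn : ∀ (p : Input r × W.Out),
      0 ≤ W.joint p.1 p.2 * W.joint (p.1 + v) p.2 / W.outLaw p.2 := fun p =>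
    div_nonneg (mul_nonneg (W.joint_nonneg _ _) (W.joint_nonneg _ _)) (W.outLaw_nonneg _)
  have h : W.bhattShift v = ∑ p : Input r × W.Out,
      √(W.outLaw p.2) * √(W.joint p.1 p.2 * W.joint (p.1 + v) p.2 / W.outLaw p.2) := by
    rw [bhattShift_eq_sum, Fintype.sum_prod_type]
    refine Finset.sum_congr rfl fun x _ => Finset.sum_congr rfl fun y _ => ?_
    rw [← Real.sqrt_mul (W.outLaw_nonneg _)]
    rcases eq_or_ne (W.outLaw y) 0 with h | h
    · have : W.joint x y = 0 := le_antisymm (h ▸ W.joint_le_outLaw x y) (W.joint_nonneg x y)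
      simp [this]
    · rw [mul_div_cancel₀ _ h]
  rw [h]
  refine (Finset.sum_mul_sq_le_sq_mul_sq _ _ _).trans_eq ?_
  simp only [Real.sq_sqrt (hn _), Real.sq_sqrt (W.outLaw_nonneg _), Fintype.sum_prod_type,
    sum_outLaw]
  simp [collision, ZMod.card]

/-- If two posterior samples of the input differ by `v` with positive probability, then the loss of
capacity controls how far the channel is from being invariant under translation by `v`. The two
factors separate because `Y₁` and `Y₂` are independent. -/
theorem collision_mul_le (v : Input r) :
    W.collision v * (1 - W.bhattShift v) ≤
      2 * ((W.symCapacity - W.minus.symCapacity) * Real.log 2) := by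
  have hsqrt : ∀ u₁ u₂ y₁ y₂, (√(W.joint (u₁ + u₂) y₁ * W.joint u₂ y₂) -
      √(W.condIndepLaw u₁ u₂ y₁ y₂)) ^ 2 =
      W.joint u₂ y₂ * (√(W.joint (u₁ + u₂) y₁) -
        √(W.minusJoint u₁ y₁ y₂ / W.outLaw y₂)) ^ 2 := by
    intro u₁ u₂ y₁ y₂
    rw [condIndepLaw, Real.sqrt_mul (W.joint_nonneg _ _),
      Real.sqrt_mul (div_nonneg (W.minusJoint_nonneg _ _ _) (W.outLaw_nonneg _)), ← sub_mul,
      mul_pow, Real.sq_sqrt (W.joint_nonneg _ _), mul_comm]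
  -- Under `condIndepLaw` the conditional law `K²` of `(U₁, Y₁)` given `(U₂, Y₂)` does not depend on
  -- `U₂`, so `K` serves as a common midpoint for the values `U₂ = u₂` and `U₂ = u₂ + v`.
  have key : ∀ u₁ u₂ y₁ y₂, W.joint u₂ y₂ * W.joint (u₂ + v) y₂ / W.outLaw y₂ *
      (√(W.joint (u₁ + u₂) y₁) - √(W.joint (u₁ + (u₂ + v)) y₁)) ^ 2 ≤
      2 * (√(W.joint (u₁ + u₂) y₁ * W.joint u₂ y₂) - √(W.condIndepLaw u₁ u₂ y₁ y₂)) ^ 2 +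
      2 * (√(W.joint (u₁ + (u₂ + v)) y₁ * W.joint (u₂ + v) y₂) -
        √(W.condIndepLaw u₁ (u₂ + v) y₁ y₂)) ^ 2 := by
    intro u₁ u₂ y₁ y₂
    rw [hsqrt, hsqrt]
    set K := √(W.minusJoint u₁ y₁ y₂ / W.outLaw y₂)
    have h1 : W.joint u₂ y₂ * W.joint (u₂ + v) y₂ / W.outLaw y₂ ≤ W.joint u₂ y₂ := by
      rw [mul_div_assoc]
      exact mul_le_of_le_one_right (W.joint_nonneg _ _)
        (div_le_one_of_le₀ (W.joint_le_outLaw _ _) (W.outLaw_nonneg _))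
    have h2 : W.joint u₂ y₂ * W.joint (u₂ + v) y₂ / W.outLaw y₂ ≤ W.joint (u₂ + v) y₂ := by
      rw [mul_comm, mul_div_assoc]
      exact mul_le_of_le_one_right (W.joint_nonneg _ _)
        (div_le_one_of_le₀ (W.joint_le_outLaw _ _) (W.outLaw_nonneg _))
    have h0 : 0 ≤ W.joint u₂ y₂ * W.joint (u₂ + v) y₂ / W.outLaw y₂ :=
      div_nonneg (mul_nonneg (W.joint_nonneg _ _) (W.joint_nonneg _ _)) (W.outLaw_nonneg _)
    have h3 := mul_le_mul_of_nonneg_right h1 (sq_nonneg (√(W.joint (u₁ + u₂) y₁) - K))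
    have h4 := mul_le_mul_of_nonneg_right h2 (sq_nonneg (√(W.joint (u₁ + (u₂ + v)) y₁) - K))
    have h5 := mul_nonneg h0 (sq_nonneg (√(W.joint (u₁ + u₂) y₁) - K +
      (√(W.joint (u₁ + (u₂ + v)) y₁) - K)))
    linarith
  have hsum := Finset.sum_le_sum fun u₁ (_ : u₁ ∈ Finset.univ) => Finset.sum_le_sum
    fun u₂ (_ : u₂ ∈ Finset.univ) => Finset.sum_le_sum fun y₁ (_ : y₁ ∈ Finset.univ) =>
      Finset.sum_le_sum fun y₂ (_ : y₂ ∈ Finset.univ) => key u₁ u₂ y₁ y₂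
  have hright : ∀ u₁, ∑ u₂, ∑ y₁, ∑ y₂,
      (√(W.joint (u₁ + (u₂ + v)) y₁ * W.joint (u₂ + v) y₂) -
        √(W.condIndepLaw u₁ (u₂ + v) y₁ y₂)) ^ 2 =
      ∑ u₂, ∑ y₁, ∑ y₂, (√(W.joint (u₁ + u₂) y₁ * W.joint u₂ y₂) -
        √(W.condIndepLaw u₁ u₂ y₁ y₂)) ^ 2 := fun u₁ =>
    Equiv.sum_comp (Equiv.addRight v) fun u₂ => ∑ y₁, ∑ y₂,
      (√(W.joint (u₁ + u₂) y₁ * W.joint u₂ y₂) - √(W.condIndepLaw u₁ u₂ y₁ y₂)) ^ 2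
  have hleft : ∀ u₂, ∑ u₁, ∑ y₁, (√(W.joint (u₁ + u₂) y₁) - √(W.joint (u₁ + (u₂ + v)) y₁)) ^ 2 =
      2 * (1 - W.bhattShift v) := by
    intro u₂
    rw [← sum_sq_sqrt_joint_sub]
    simp only [← add_assoc]
    exact Equiv.sum_comp (Equiv.addRight u₂)
      fun x => ∑ y, (√(W.joint x y) - √(W.joint (x + v) y)) ^ 2
  simp only [Finset.sum_add_distrib, ← Finset.mul_sum, hright] at hsum
  rw [Finset.sum_comm] at hsum
  simp only [← Finset.sum_mul] at hsum
  simp only [← Finset.mul_sum, hleft] at hsum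
  simp only [← Finset.sum_mul] at hsum
  rw [← collision] at hsum
  linarith [W.hellinger_le]

/-- A small loss of capacity under the `-` transform forces each `Z_v` to be close to `0` or
to `1`. -/
theorem bhattShift_sq_mul_le (v : Input r) :
    W.bhattShift v ^ 2 * (1 - W.bhattShift v) ≤
      2 ^ r * (2 * Real.log 2) * (W.symCapacity - W.minus.symCapacity) := by
  have h1 := mul_le_mul_of_nonneg_right (W.bhattShift_sq_le v)
    (sub_nonneg.2 (W.bhattShift_le_one v))
  have h2 := mul_le_mul_of_nonneg_left (W.collision_mul_le v)
    (show (0 : ℝ) ≤ 2 ^ r by positivity)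
  linarith

end Capacity
end Channel

/-! ### Subgroups of `ℤ/2^r` and the ordered weight -/

section Subgroups

variable {r : ℕ}

theorem orderedWeight_le_iff {k : ℕ} (hk : k ≤ r) (v : Input r) :
    orderedWeight v ≤ k ↔ 2 ^ (r - k) ∣ v.val := by
  have hw : orderedWeight v ≤ k ↔
      ∀ j, (1 ≤ j ∧ j ≤ r) ∧ v.val.testBit (r - j) = true → j ≤ k := by
    simp only [orderedWeight, Finset.sup_le_iff, Finset.mem_filter, Finset.mem_Icc, id_eq]
    rfl
  rw [hw]
  constructor
  · intro h
    rw [Nat.dvd_iff_mod_eq_zero]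
    refine Nat.eq_of_testBit_eq fun i => ?_
    rw [Nat.testBit_mod_two_pow, Nat.zero_testBit]
    by_cases hi : i < r - k
    · by_contra hb
      have := h (r - i) ⟨⟨by omega, by omega⟩, by
        rw [show r - (r - i) = i by omega]; simpa [hi] using hb⟩
      omega
    · simp [hi]
  · rintro ⟨c, hc⟩ j ⟨⟨h1, h2⟩, hb⟩
    by_contra hj
    rw [hc, Nat.testBit_two_pow_mul] at hb
    simp at hb
    omega

theorem orderedWeight_le (v : Input r) : orderedWeight v ≤ r := by
  rw [orderedWeight_le_iff le_rfl]
  simp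

theorem card_orderedWeight_le {k : ℕ} (hk : k ≤ r) :
    (Finset.univ.filter fun v : Input r => orderedWeight v ≤ k).card = 2 ^ k := by
  have hpow : 2 ^ r = 2 ^ (r - k) * 2 ^ k := by rw [← pow_add]; congr 1; omega
  have hlt : ∀ a < 2 ^ k, 2 ^ (r - k) * a < 2 ^ r := fun a ha => by
    rw [hpow]
    exact Nat.mul_lt_mul_of_pos_left ha (by positivity)
  rw [← Finset.card_range (2 ^ k)]
  symm
  refine Finset.card_bij (fun a _ => ((2 ^ (r - k) * a : ℕ) : Input r)) ?_ ?_ ?_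
  · intro a ha
    rw [Finset.mem_filter, orderedWeight_le_iff hk,
      ZMod.val_cast_of_lt (hlt a (Finset.mem_range.1 ha))]
    exact ⟨Finset.mem_univ _, dvd_mul_right _ _⟩
  · intro a ha b hb hab
    have := congrArg ZMod.val hab
    rw [ZMod.val_cast_of_lt (hlt a (Finset.mem_range.1 ha)),
      ZMod.val_cast_of_lt (hlt b (Finset.mem_range.1 hb))] at this
    exact Nat.eq_of_mul_eq_mul_left (by positivity) this
  · intro v hv
    rw [Finset.mem_filter, orderedWeight_le_iff hk] at hv
    obtain ⟨c, hc⟩ := hv.2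
    refine ⟨c, Finset.mem_range.2 ?_, ?_⟩
    · have := ZMod.val_lt v
      rw [hc] at this
      exact Nat.lt_of_mul_lt_mul_left (this.trans_eq hpow)
    · rw [← hc, ZMod.natCast_zmod_val]

theorem card_orderedWeight_eq {i : ℕ} (h1 : 1 ≤ i) (hi : i ≤ r) :
    (Finset.univ.filter fun v : Input r => orderedWeight v = i).card = 2 ^ (i - 1) := by
  have h := card_orderedWeight_le hi
  have h' := card_orderedWeight_le (show i - 1 ≤ r by omega)
  have hsplit : (Finset.univ.filter fun v : Input r => orderedWeight v ≤ i) =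
      (Finset.univ.filter fun v : Input r => orderedWeight v ≤ i - 1) ∪
        Finset.univ.filter fun v : Input r => orderedWeight v = i := by
    ext v
    simp only [Finset.mem_union, Finset.mem_filter, Finset.mem_univ, true_and]
    omega
  rw [hsplit, Finset.card_union_of_disjoint, h'] at h
  · have : 2 ^ i = 2 * 2 ^ (i - 1) := by rw [← pow_succ']; congr 1; omega
    omega
  · rw [Finset.disjoint_filter]
    intro v _ _
    omega

/-- The subgroups of `ℤ/2^r` (which, the group being finite, are its submonoids) form a chain, and
each is a ball for the ordered weight. -/
theorem exists_mem_iff_orderedWeight_le (S : AddSubmonoid (Input r)) :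
    ∃ k ≤ r, ∀ v, v ∈ S ↔ orderedWeight v ≤ k := by
  obtain ⟨g, hg, hmax⟩ := Set.exists_max_image (S : Set (Input r)) orderedWeight
    (Set.toFinite _) ⟨0, S.zero_mem⟩
  refine ⟨orderedWeight g, orderedWeight_le g, fun v => ⟨hmax v, fun hv => ?_⟩⟩
  set k := orderedWeight g with hk
  have hkr : k ≤ r := orderedWeight_le g
  obtain ⟨a, ha⟩ := (orderedWeight_le_iff hkr g).1 le_rfl
  obtain ⟨b, hb⟩ := (orderedWeight_le_iff hkr v).1 hv
  have hgc : g = (2 ^ (r - k) : Input r) * a := by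
    rw [← ZMod.natCast_zmod_val g, ha]; push_cast; ring
  have hvc : v = (2 ^ (r - k) : Input r) * b := by
    rw [← ZMod.natCast_zmod_val v, hb]; push_cast; ring
  rcases Nat.eq_zero_or_pos k with h0 | hpos
  · have : v = 0 := by
      rw [hvc, h0, Nat.sub_zero]
      have : ((2 ^ r : ℕ) : Input r) = 0 := ZMod.natCast_self _
      push_cast at this
      rw [this, zero_mul]
    exact this ▸ S.zero_mem
  -- Maximality of the weight makes the cofactor `a` odd, hence a unit.
  have hodd : Nat.Coprime a (2 ^ r) := by
    refine Nat.Coprime.pow_right _ (Nat.coprime_two_right.2 ?_)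
    by_contra hev
    obtain ⟨c, hc⟩ := (Nat.not_odd_iff_even.1 hev).two_dvd
    have : orderedWeight g ≤ k - 1 := by
      rw [orderedWeight_le_iff (by omega), ha, hc, ← mul_assoc, ← pow_succ,
        show r - k + 1 = r - (k - 1) by omega]
      exact dvd_mul_right _ _
    omega
  obtain ⟨w, hw⟩ := (ZMod.isUnit_iff_coprime a (2 ^ r)).2 hodd
  have : v = (((w⁻¹ : (Input r)ˣ) : Input r) * b).val • g := by
    rw [nsmul_eq_mul, ZMod.natCast_zmod_val, hgc, ← hw, hvc]
    have := w.inv_mul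
    linear_combination (-(2 ^ (r - k) : Input r) * b) * this
  rw [this]
  exact S.nsmul_mem hg _

end Subgroups

/-! ### Polarization along a path -/

section Dynamics

variable {r : ℕ}

theorem tendsto_avgBhatt {V : ℕ → Channel.{u} r} {k : ℕ}
    (h : ∀ v, Tendsto (fun n => (V n).bhattShift v) atTop
      (𝓝 (if orderedWeight v ≤ k then 1 else 0))) {i : ℕ} (hi : i ∈ Finset.Icc 1 r) :
    Tendsto (fun n => (V n).avgBhatt i) atTop (𝓝 (if i ≤ k then 1 else 0)) := by
  rw [Finset.mem_Icc] at hi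
  have hlim := (tendsto_finsetSum
    ((Finset.univ : Finset (Input r)).filter fun v => orderedWeight v = i)
    fun v _ => h v).const_mul (1 / 2 ^ (i - 1) : ℝ)
  have hsum : ∑ v ∈ (Finset.univ : Finset (Input r)).filter (fun v => orderedWeight v = i),
      (if orderedWeight v ≤ k then (1 : ℝ) else 0) = 2 ^ (i - 1) * if i ≤ k then 1 else 0 := by
    rw [Finset.sum_congr rfl fun v hv => by rw [(Finset.mem_filter.1 hv).2], Finset.sum_const,
      card_orderedWeight_eq hi.1 hi.2, nsmul_eq_mul]
    push_cast
    rfl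
  rw [hsum, ← mul_assoc, one_div, inv_mul_cancel₀ (by positivity), one_mul, ← one_div] at hlim
  exact hlim

/-- A sequence of virtual channels along which the capacity lost by the `-` transform tends to
zero polarizes: each `Z_v` converges, and the limit is the indicator of a subgroup. -/
theorem exists_tendsto_bhattShift {V : ℕ → Channel.{u} r}
    (hV : ∀ n, V (n + 1) = (V n).plus ∨ V (n + 1) = (V n).minus)
    (hΔ : Tendsto (fun n => (V n).symCapacity - (V n).minus.symCapacity) atTop (𝓝 0)) :
    ∃ k ≤ r, ∀ v, Tendsto (fun n => (V n).bhattShift v) atTop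
      (𝓝 (if orderedWeight v ≤ k then 1 else 0)) := by
  have hprod : ∀ v, Tendsto (fun n => (V n).bhattShift v ^ 2 * (1 - (V n).bhattShift v)) atTop
      (𝓝 0) := by
    intro v
    refine squeeze_zero (fun n => mul_nonneg (sq_nonneg _)
      (sub_nonneg.2 ((V n).bhattShift_le_one v))) (fun n => (V n).bhattShift_sq_mul_le v) ?_
    simpa using hΔ.const_mul (2 ^ r * (2 * Real.log 2))
  -- With this margin a sum of `2 ^ r` terms below `δ` stays below `1/2`, as in the bound for
  -- `Z_v(W⁻)`, and `(1 - δ)²` and `1 - 4δ` stay above `1/2`.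
  set δ : ℝ := 1 / (2 ^ r * 16) with hδ
  have hδ0 : 0 < δ := by positivity
  have hδr : 2 ^ r * δ = 1 / 16 := by rw [hδ]; field_simp
  have hδ1 : δ ≤ 1 / 16 := by
    rw [← hδr]
    exact le_mul_of_one_le_left hδ0.le (one_le_pow₀ one_le_two)
  obtain ⟨N, hN⟩ : ∃ N, ∀ n ≥ N, ∀ v,
      (V n).bhattShift v ^ 2 * (1 - (V n).bhattShift v) < δ ^ 2 / 2 :=
    eventually_atTop.1 (eventually_all.2 fun v => (hprod v).eventually_lt_const (by positivity))
  have hlow : ∀ n ≥ N, ∀ v, (V n).bhattShift v ≤ 1 / 2 → (V n).bhattShift v ≤ δ := by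
    intro n hn v hv
    have h := hN n hn v
    have h0 := (V n).bhattShift_nonneg v
    by_contra! hc
    nlinarith [mul_pos hδ0 hδ0]
  have hhigh : ∀ n ≥ N, ∀ v, 1 / 2 < (V n).bhattShift v → 1 - δ ≤ (V n).bhattShift v := by
    intro n hn v hv
    have h := hN n hn v
    have h1 := (V n).bhattShift_le_one v
    have hsq : 1 / 4 ≤ (V n).bhattShift v ^ 2 := by nlinarith
    have := mul_le_mul_of_nonneg_right hsq (sub_nonneg.2 h1)
    nlinarith
  have hadd : ∀ n ≥ N, ∀ v w, 1 / 2 < (V n).bhattShift v → 1 / 2 < (V n).bhattShift w →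
      1 / 2 < (V n).bhattShift (v + w) := by
    intro n hn v w hv hw
    have := (V n).one_sub_bhattShift_add_le v w
    linarith [hhigh n hn v hv, hhigh n hn w hw]
  have hstep : ∀ n ≥ N, ∀ v, 1 / 2 < (V (n + 1)).bhattShift v ↔ 1 / 2 < (V n).bhattShift v := by
    intro n hn v
    have h0 := (V n).bhattShift_nonneg v
    have h1 := (V n).bhattShift_le_one v
    rcases hV n with h | h
    · rw [h, Channel.bhattShift_plus]
      constructor
      · intro h'
        nlinarith
      · intro h'
        nlinarith [hhigh n hn v h']
    · rw [h]
      refine ⟨fun h' => ?_, fun h' => h'.trans_le ((V n).bhattShift_le_minus v)⟩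
      by_contra! hv
      -- Of `d` and `v + d` at least one lies outside the subgroup `{v | 1/2 < Z_v}`.
      have hterm : ∀ d, (V n).bhattShift d * (V n).bhattShift (v + d) ≤ δ := by
        intro d
        rcases le_or_gt ((V n).bhattShift d) (1 / 2) with hd | hd
        · exact (mul_le_of_le_one_right ((V n).bhattShift_nonneg _)
            ((V n).bhattShift_le_one _)).trans (hlow n hn d hd)
        · refine (mul_le_of_le_one_left ((V n).bhattShift_nonneg _)
            ((V n).bhattShift_le_one _)).trans (hlow n hn _ ?_)
          by_contra! hvd
          have := hadd n hn (v + d) (-d) hvd (by rwa [Channel.bhattShift_neg])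
          rw [add_neg_cancel_right] at this
          linarith
      have hsum := ((V n).bhattShift_minus_le v).trans
        (Finset.sum_le_sum fun d _ => hterm d)
      rw [Finset.sum_const, Finset.card_univ, ZMod.card, nsmul_eq_mul] at hsum
      push_cast at hsum
      linarith
  -- Hence `{v | 1/2 < Z_v}` is the same subgroup at all times from `N` on.
  have hconst : ∀ v, ∀ n ≥ N, (1 / 2 < (V n).bhattShift v ↔ 1 / 2 < (V N).bhattShift v) := by
    intro v n hn
    induction n, hn using Nat.le_induction with
    | base => rfl
    | succ n hn ih => rw [hstep n hn, ih]
  let S : AddSubmonoid (Input r) :=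
    { carrier := {v | 1 / 2 < (V N).bhattShift v}
      add_mem' := fun {v w} hv hw => hadd N le_rfl v w hv hw
      zero_mem' := by
        change (1 / 2 : ℝ) < _
        rw [Channel.bhattShift_zero]
        norm_num }
  obtain ⟨k, hk, hS⟩ := exists_mem_iff_orderedWeight_le S
  refine ⟨k, hk, fun v => ?_⟩
  by_cases hv : orderedWeight v ≤ k
  · rw [if_pos hv]
    have hvN : 1 / 2 < (V N).bhattShift v := (hS v).2 hv
    have h := ((hprod v).const_mul 4).const_sub 1
    rw [mul_zero, sub_zero] at h
    refine tendsto_of_tendsto_of_tendsto_of_le_of_le' h tendsto_const_nhds ?_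
      (Eventually.of_forall fun n => (V n).bhattShift_le_one v)
    filter_upwards [eventually_ge_atTop N] with n hn
    have h2 := (hconst v n hn).2 hvN
    have hsq : 1 / 4 ≤ (V n).bhattShift v ^ 2 := by nlinarith
    linarith [mul_le_mul_of_nonneg_right hsq (sub_nonneg.2 ((V n).bhattShift_le_one v))]
  · rw [if_neg hv]
    have hvN : ¬ 1 / 2 < (V N).bhattShift v := fun h => hv ((hS v).1 h)
    have h := ((hprod v).const_mul 2).sqrt
    rw [mul_zero, Real.sqrt_zero] at h
    refine tendsto_of_tendsto_of_tendsto_of_le_of_le' tendsto_const_nhds h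
      (Eventually.of_forall fun n => (V n).bhattShift_nonneg v) ?_
    filter_upwards [eventually_ge_atTop N] with n hn
    have h2 := not_lt.1 (mt (hconst v n hn).1 hvN)
    refine Real.le_sqrt_of_sq_le ?_
    nlinarith [sq_nonneg ((V n).bhattShift v)]

end Dynamics

/-! ### The capacity martingale -/

section Probability

variable {r : ℕ}

/-- The signs as real numbers: `1` for `+` and `-1` for `-`. -/
def signValue (n : ℕ) (ω : SignSeq) : ℝ := if ω n then 1 else -1

theorem measurable_signValue (n : ℕ) : Measurable (signValue n) :=
  (measurable_of_finite fun b : Bool => if b then (1 : ℝ) else -1).comp (measurable_pi_apply n)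

theorem iIndepFun_signValue : iIndepFun signValue signMeasure :=
  iIndepFun_infinitePi (P := fun _ : ℕ => fairSign)
    (X := fun _ (b : Bool) => if b then (1 : ℝ) else -1) fun _ => measurable_of_finite _

theorem integral_signValue (n : ℕ) : ∫ ω, signValue n ω ∂signMeasure = 0 := by
  have hmp := measurePreserving_eval_infinitePi (fun _ : ℕ => fairSign) n
  have h : ∫ b : Bool, (if b then (1 : ℝ) else -1) ∂fairSign = 0 := by
    rw [fairSign, PMF.integral_eq_sum]
    simp
  rw [← h, ← hmp.map_eq, integral_map hmp.aemeasurable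
    (measurable_of_finite _).aestronglyMeasurable]
  rfl

theorem integrable_signValue (n : ℕ) : Integrable (signValue n) signMeasure :=
  Integrable.of_bound (measurable_signValue n).aestronglyMeasurable 1
    (Eventually.of_forall fun ω => by rw [signValue]; split_ifs <;> simp)

/-- The filtration of the signs, shifted by one: time `n` knows the first `n` signs, where
`Filtration.natural` at time `n` also knows the sign with index `n`. -/
def signFiltration : Filtration ℕ (inferInstance : MeasurableSpace SignSeq) where
  seq n := ⨆ j < n, MeasurableSpace.comap (signValue j) inferInstance
  mono' _ _ hmn := biSup_mono fun _ hj => hj.trans_le hmn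
  le' _ := iSup₂_le fun j _ => (measurable_signValue j).comap_le

theorem condExp_signValue (n : ℕ) :
    signMeasure[signValue n | signFiltration n] =ᵐ[signMeasure] 0 := by
  have hind : Indep (MeasurableSpace.comap (signValue n) inferInstance) (signFiltration n)
      signMeasure := by
    have h := indep_iSup_of_disjoint (fun j => (measurable_signValue j).comap_le)
      iIndepFun_signValue (S := {n}) (T := {j | j < n})
      (Set.disjoint_singleton_left.2 (lt_irrefl n))
    rw [iSup_singleton] at h
    exact h
  refine (condExp_indep_eq (measurable_signValue n).comap_le (signFiltration.le n)
    (comap_measurable _).stronglyMeasurable hind).trans ?_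
  rw [integral_signValue]
  rfl

/-- Any functional of the virtual channel at time `n` depends on the first `n` signs only. -/
theorem measurable_virtualChannel (W : Channel.{u} r) (n : ℕ) (F : Channel.{u} r → ℝ) :
    Measurable[signFiltration n] fun ω => F (virtualChannel W ω n) := by
  induction n generalizing F with
  | zero => exact measurable_const (a := F W)
  | succ n ih =>
    have hs : MeasurableSet[signFiltration (n + 1)] {ω : SignSeq | ω n = true} := by
      have hle : MeasurableSpace.comap (signValue n) inferInstance ≤ signFiltration (n + 1) :=
        le_iSup₂_of_le n (Nat.lt_succ_self n) le_rfl
      refine hle _ ⟨{1}, measurableSet_singleton 1, ?_⟩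
      ext ω
      rcases h : ω n <;> simp [signValue, h]
      norm_num
    have heq : (fun ω => F (virtualChannel W ω (n + 1))) = fun ω =>
        if ω n = true then F (virtualChannel W ω n).plus else F (virtualChannel W ω n).minus :=
      funext fun ω => by
        rw [virtualChannel]
        split_ifs <;> rfl
    rw [heq]
    exact Measurable.ite hs ((ih fun V => F V.plus).mono (signFiltration.mono n.le_succ) le_rfl)
      ((ih fun V => F V.minus).mono (signFiltration.mono n.le_succ) le_rfl)

theorem measurable_virtualChannel' (W : Channel.{u} r) (n : ℕ) (F : Channel.{u} r → ℝ) :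
    Measurable fun ω => F (virtualChannel W ω n) :=
  (measurable_virtualChannel W n F).mono (signFiltration.le n) le_rfl

theorem abs_symCapacity_le (V : Channel.{u} r) : |V.symCapacity| ≤ r :=
  abs_le.2 ⟨by linarith [V.symCapacity_nonneg, Nat.cast_nonneg (α := ℝ) r], V.symCapacity_le⟩

theorem integrable_symCapacity (W : Channel.{u} r) (n : ℕ) :
    Integrable (fun ω => (virtualChannel W ω n).symCapacity) signMeasure :=
  Integrable.of_bound (measurable_virtualChannel' W n _).aestronglyMeasurable r
    (Eventually.of_forall fun _ => abs_symCapacity_le _)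

theorem symCapacity_virtualChannel_succ (W : Channel.{u} r) (ω : SignSeq) (n : ℕ) :
    (virtualChannel W ω (n + 1)).symCapacity = (virtualChannel W ω n).symCapacity +
      ((virtualChannel W ω n).symCapacity - (virtualChannel W ω n).minus.symCapacity) *
        signValue n ω := by
  have h := (virtualChannel W ω n).symCapacity_minus_add_plus
  simp only [virtualChannel, signValue]
  split_ifs <;> linarith

theorem martingale_symCapacity (W : Channel.{u} r) :
    Martingale (fun n ω => (virtualChannel W ω n).symCapacity) signFiltration signMeasure := by
  refine martingale_nat (fun n => (measurable_virtualChannel W n _).stronglyMeasurable)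
    (integrable_symCapacity W) fun n => ?_
  have hI : StronglyMeasurable[signFiltration n] fun ω => (virtualChannel W ω n).symCapacity :=
    (measurable_virtualChannel W n _).stronglyMeasurable
  have hD : StronglyMeasurable[signFiltration n] fun ω => (virtualChannel W ω n).symCapacity -
      (virtualChannel W ω n).minus.symCapacity :=
    (measurable_virtualChannel W n fun V => V.symCapacity - V.minus.symCapacity).stronglyMeasurable
  have hprod : Integrable ((fun ω => (virtualChannel W ω n).symCapacity -
      (virtualChannel W ω n).minus.symCapacity) * signValue n) signMeasure := by
    refine ((integrable_symCapacity W (n + 1)).sub (integrable_symCapacity W n)).congr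
      (Eventually.of_forall fun ω => ?_)
    simp only [Pi.sub_apply, Pi.mul_apply, symCapacity_virtualChannel_succ]
    ring
  have hsucc : (fun ω => (virtualChannel W ω (n + 1)).symCapacity) =
      (fun ω => (virtualChannel W ω n).symCapacity) + (fun ω => (virtualChannel W ω n).symCapacity -
        (virtualChannel W ω n).minus.symCapacity) * signValue n :=
    funext fun ω => symCapacity_virtualChannel_succ W ω n
  rw [hsucc]
  have h1 := condExp_add (integrable_symCapacity W n) hprod (signFiltration n)
  have h2 := condExp_mul_of_stronglyMeasurable_left hD hprod (integrable_signValue n)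
  rw [condExp_of_stronglyMeasurable (signFiltration.le n) hI (integrable_symCapacity W n)] at h1
  filter_upwards [h1, h2, condExp_signValue n] with ω h1 h2 h3
  rw [h1, Pi.add_apply, h2, Pi.mul_apply, h3]
  simp

theorem exists_measurable_tendsto_symCapacity (W : Channel.{u} r) :
    ∃ L : SignSeq → ℝ, Measurable L ∧ ∀ᵐ ω ∂signMeasure,
      Tendsto (fun n => (virtualChannel W ω n).symCapacity) atTop (𝓝 (L ω)) := by
  have h := (martingale_symCapacity W).submartingale.exists_ae_tendsto_of_bdd (R := r)
    fun n => by
      refine (eLpNorm_le_of_ae_bound (C := r)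
        (Eventually.of_forall fun ω => abs_symCapacity_le _)).trans ?_
      simp
  obtain ⟨L, hL, hlim⟩ := exists_stronglyMeasurable_limit_of_tendsto_ae
    (fun n => (integrable_symCapacity W n).aestronglyMeasurable) h
  exact ⟨L, hL.measurable, hlim⟩

/-- Along almost every path the step of the capacity martingale, which up to sign is the capacity
lost by the `-` transform, tends to zero. -/
theorem ae_exists_tendsto_bhattShift (W : Channel.{u} r) :
    ∀ᵐ ω ∂signMeasure, ∃ k ≤ r, ∀ v,
      Tendsto (fun n => (virtualChannel W ω n).bhattShift v) atTop
        (𝓝 (if orderedWeight v ≤ k then 1 else 0)) := by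
  obtain ⟨L, -, hL⟩ := exists_measurable_tendsto_symCapacity W
  filter_upwards [hL] with ω hω
  refine exists_tendsto_bhattShift (fun n => ?_) ?_
  · rw [virtualChannel]
    split_ifs
    exacts [.inl rfl, .inr rfl]
  · have h := (hω.comp (tendsto_add_atTop_nat 1)).sub hω
    rw [sub_self] at h
    refine squeeze_zero_norm (fun n => le_of_eq ?_) (tendsto_zero_iff_norm_tendsto_zero.1 h)
    have hs : |signValue n ω| = 1 := by rw [signValue]; split_ifs <;> simp
    simp only [Function.comp_apply, symCapacity_virtualChannel_succ, add_sub_cancel_left,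
      norm_mul, Real.norm_eq_abs, hs, mul_one]

end Probability
end PolarQ

/-- Polarization of the virtual channels obtained from a `2 ^ r`-ary channel with the kernel `H₂`
and addition modulo `2 ^ r`. -/
theorem theorem1 {r : ℕ} (hr : 1 ≤ r) (W : PolarQ.Channel r) :
    (∃ Iinf : PolarQ.SignSeq → ℝ,
      Measurable Iinf ∧
      (∀ᵐ ω ∂PolarQ.signMeasure,
        Tendsto (fun n => (PolarQ.virtualChannel W ω n).symCapacity) atTop (𝓝 (Iinf ω))) ∧
      Integrable Iinf PolarQ.signMeasure ∧
      ∫ ω, Iinf ω ∂PolarQ.signMeasure = W.symCapacity) ∧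
    (∃ Zinf : ℕ → PolarQ.SignSeq → ℝ,
      (∀ i ∈ Finset.Icc 1 r,
        Measurable (Zinf i) ∧
        (∀ ω, Zinf i ω = 0 ∨ Zinf i ω = 1) ∧
        ∀ᵐ ω ∂PolarQ.signMeasure,
          Tendsto (fun n => (PolarQ.virtualChannel W ω n).avgBhatt i) atTop (𝓝 (Zinf i ω))) ∧
      ∀ᵐ ω ∂PolarQ.signMeasure, ∃ k ≤ r, ∀ i ∈ Finset.Icc 1 r,
        Zinf i ω = if i ≤ k then 1 else 0) := by
  classical
  constructor
  · obtain ⟨L, hmeas, hL⟩ := PolarQ.exists_measurable_tendsto_symCapacity W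
    refine ⟨L, hmeas, hL, ?_, ?_⟩
    · refine Integrable.of_bound hmeas.aestronglyMeasurable r ?_
      filter_upwards [hL] with ω hω
      exact le_of_tendsto hω.norm (Eventually.of_forall fun n => PolarQ.abs_symCapacity_le _)
    · have hlim := tendsto_integral_of_dominated_convergence (μ := PolarQ.signMeasure)
        (fun _ => (r : ℝ)) (fun n => (PolarQ.integrable_symCapacity W n).aestronglyMeasurable)
        (integrable_const _)
        (fun n => Eventually.of_forall fun ω => PolarQ.abs_symCapacity_le _) hL
      refine tendsto_nhds_unique hlim ?_
      have hconst : ∀ n, ∫ ω, (PolarQ.virtualChannel W ω n).symCapacity ∂PolarQ.signMeasure =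
          W.symCapacity := by
        intro n
        have := (PolarQ.martingale_symCapacity W).setIntegral_eq n.zero_le MeasurableSet.univ
        simp only [setIntegral_univ] at this
        rw [← this]
        simp [PolarQ.virtualChannel]
      simp only [hconst]
      exact tendsto_const_nhds
  · have hZ : ∀ᵐ ω ∂PolarQ.signMeasure, ∃ k ≤ r, ∀ i ∈ Finset.Icc 1 r,
        Tendsto (fun n => (PolarQ.virtualChannel W ω n).avgBhatt i) atTop
          (𝓝 (if i ≤ k then 1 else 0)) := by
      filter_upwards [PolarQ.ae_exists_tendsto_bhattShift W] with ω ⟨k, hk, h⟩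
      exact ⟨k, hk, fun i hi => PolarQ.tendsto_avgBhatt h hi⟩
    -- Off the null set without convergence the limit is given the value `0`.
    let Z : ℕ → PolarQ.SignSeq → ℝ := fun i ω =>
      if Tendsto (fun n => (PolarQ.virtualChannel W ω n).avgBhatt i) atTop (𝓝 1) then 1 else 0
    have hval : ∀ᵐ ω ∂PolarQ.signMeasure, ∃ k ≤ r, ∀ i ∈ Finset.Icc 1 r,
        Z i ω = (if i ≤ k then 1 else 0) ∧
        Tendsto (fun n => (PolarQ.virtualChannel W ω n).avgBhatt i) atTop (𝓝 (Z i ω)) := by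
      filter_upwards [hZ] with ω ⟨k, hk, h⟩
      refine ⟨k, hk, fun i hi => ?_⟩
      have hzi : Z i ω = if i ≤ k then 1 else 0 := by
        have hi' := h i hi
        by_cases hik : i ≤ k
        · rw [if_pos hik] at hi' ⊢
          exact if_pos hi'
        · rw [if_neg hik] at hi' ⊢
          exact if_neg fun h1 => zero_ne_one (tendsto_nhds_unique hi' h1)
      exact ⟨hzi, hzi ▸ h i hi⟩
    refine ⟨Z, fun i hi => ⟨?_, fun ω => (ite_eq_or_eq _ _ _).symm, ?_⟩, ?_⟩
    · exact Measurable.ite (measurableSet_tendsto _ fun n =>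
        PolarQ.measurable_virtualChannel' W n fun V => V.avgBhatt i)
        measurable_const measurable_const
    · filter_upwards [hval] with ω ⟨k, _, h⟩
      exact (h i hi).2
    · filter_upwards [hval] with ω ⟨k, hk, h⟩
      exact ⟨k, hk, fun i hi => (h i hi).1⟩
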